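/- Let $f:\mathbb N_0\to\mathbb C$ be the bosonic factor of a generalized boson, $(b^\dagger)^n|0\rangle=f(n)|n\rangle$, with $f(0)=1$, $f(1)\neq 0$, and $N(\alpha)=\sum_{n\ge 0}\frac{|\alpha|^{2n}|f(n)|^2}{n!^2}<\infty$ for all $\alpha\in\mathbb C$ (for real $f$, $|f(n)|^2=f(n)^2$). Let $|\alpha\rangle=N(\alpha)^{-1/2}\sum_{n\ge 0}\frac{\alpha^n}{n!}f(n)|n\rangle$ be the generalized coherent states, write $|\boldsymbol\alpha\rangle=|\alpha_1\rangle\otimes\cdots\otimes|\alpha_M\rangle$ for $\boldsymbol\alpha\in\mathbb C^M$, and write $\ln N(|\alpha|)=c_0+c_1|\alpha|^2+c_2|\alpha|^4+\cdots$ near $\alpha=0$. Let $\rho$ be a density operator on the $M$-mode Fock space, let $\kappa>0$, and let $Q_\rho(\boldsymbol\alpha)=\kappa^{-M}\langle\boldsymbol\alpha|\rho|\boldsymbol\alpha\rangle$ be its $Q$-function. For $\boldsymbol\alpha\in\mathbb C^M$ put $v_{\boldsymbol\alpha}=(\alpha_1,\dots,\alpha_M,\alpha_1^*,\dots,\alpha_M^*)^T\in\mathbb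 C^{2M}$. Let $\sigma_Q$ be a $2M\times 2M$ positive definite covariance matrix with respect to these coordinates, i.e. its entries satisfy $(\sigma_Q)_{\bar i\,\bar j}=(\sigma_Q)_{ij}^*$, where $i\mapsto\bar i$ exchanges the indices $j$ and $M+j$; let $|\sigma_Q|$ be its determinant. Let $\boldsymbol n=(n_1,\dots,n_M)$ with all $n_j\in\{0,1\}$, let $S=\{j,\,M+j : n_j=1\}\subseteq\{1,\dots,2M\}$, let $\mathrm{Pr}(\boldsymbol n)=\langle\boldsymbol n|\rho|\boldsymbol n\rangle$ be the probability of the outcome $\boldsymbol n$ of a measurement in the Fock basis, and let $$A=\begin{pmatrix}0&I_M\\ I_M&0\end{pmatrix}\bigl(c_1I_{2M}-\sigma_Q^{-1}\bigr).$$ For $B\subseteq\{1,\dots,2M\}$ let $A_B$ be the submatrix of $A$ with rows and columns in $B$. ($\mathrm{Haf}$ of the empty matrix is $1$ and $\mathrm{Haf}$ of a matrix of odd size is $0$.) 1. If $Q_\rho(\boldsymbol\alpha)=\frac{1}{g\sqrt{|\sigma_Q|}}\,e^{-\frac12 v_{\boldsymbol\alpha}^\dagger\sigma_Q^{-1}v_{\boldsymbol\alpha}}$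 for all $\boldsymbol\alpha\in\mathbb C^M$, where the constant $g$ is such that $\int_{\mathbb C^M}Q_\rho(\boldsymbol\alpha)\,d^{2M}\boldsymbol\alpha=1$, then $$\mathrm{Pr}(\boldsymbol n)=\frac{\kappa^M e^{c_0M}}{g\prod_{i=1}^Mf(n_i)^2\sqrt{|\sigma_Q|}}\;\mathrm{Haf}(A_S),$$ where $f(n_i)^2$ is read as $|f(n_i)|^2$. 2. If, for some displacement $\boldsymbol\delta\in\mathbb C^M$ and with $d=v_{\boldsymbol\delta}$, $Q_\rho(\boldsymbol\alpha)=\frac{1}{g\sqrt{|\sigma_Q|}}\,e^{-\frac12 (v_{\boldsymbol\alpha}-d)^\dagger\sigma_Q^{-1}(v_{\boldsymbol\alpha}-d)}$ for all $\boldsymbol\alpha\in\mathbb C^M$, where again $g$ is such that $\int Q_\rho\,d^{2M}\boldsymbol\alpha=1$, then with $F=d^\dagger\sigma_Q^{-1}$ $$\mathrm{Pr}(\boldsymbol n)=\frac{\kappa^M e^{c_0M}\,e^{-\frac12 d^\dagger\sigma_Q^{-1}d}}{g\prod_{i=1}^Mf(n_i)^2\sqrt{|\sigma_Q|}}\;\sum_{B\subseteq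 S}\Bigl(\prod_{k\in B}F_k\Bigr)\mathrm{Haf}\bigl(A_{S\setminus B}\bigr).$$ -/

import Mathlib

open scoped Matrix ComplexOrder

noncomputable section

namespace GenBoson

/-- The bosonic factor `f` of a generalized boson, `(b†)^n |0⟩ = f(n) |n⟩`.  The last field says
that the generalized coherent state `|α⟩` exists for every amplitude `α ∈ ℂ`. -/
structure BosonicFactor where
  toFun : ℕ → ℂ
  map_zero : toFun 0 = 1
  map_one_ne_zero : toFun 1 ≠ 0
  summable_norm : ∀ x : ℝ, Summable fun n : ℕ => ‖toFun n‖ ^ 2 / (n.factorial : ℝ) ^ 2 * x ^ n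

/-- `x ↦ ∑ₙ |f(n)|² xⁿ / n!²`, the normalization `N` as a function of `x = |α|²`. -/
def normSeries (f : BosonicFactor) (x : ℝ) : ℝ :=
  ∑' n : ℕ, ‖f.toFun n‖ ^ 2 / (n.factorial : ℝ) ^ 2 * x ^ n

/-- `N(α) = ∑ₙ |α|²ⁿ |f(n)|² / n!²`. -/
def normalization (f : BosonicFactor) (α : ℂ) : ℝ :=
  normSeries f (‖α‖ ^ 2)

/-- The coefficient `c_k` in `ln N(|α|) = c_0 + c_1 |α|² + c_2 |α|⁴ + …`. -/
def logCoeff (f : BosonicFactor) (k : ℕ) : ℝ :=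
  iteratedDeriv k (fun x : ℝ => Real.log (normSeries f x)) 0 / (k.factorial : ℝ)

/-- Coefficient `⟨n|α⟩ = αⁿ f(n) / (n! √N(α))` of the single-mode coherent state. -/
def coherentCoeff (f : BosonicFactor) (α : ℂ) (n : ℕ) : ℂ :=
  α ^ n / (n.factorial : ℂ) * f.toFun n / (Real.sqrt (normalization f α) : ℂ)

/-- The Hilbert space of `M` modes, with the occupation numbers `n ∈ ℕ^M` labelling its
standard orthonormal basis. -/
abbrev FockSpace (M : ℕ) : Type := lp (fun _ : Fin M → ℕ => ℂ) 2

/-- The Fock state `|n⟩ = |n_1, …, n_M⟩`. -/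
def fockKet {M : ℕ} (n : Fin M → ℕ) : FockSpace M :=
  lp.single 2 n (1 : ℂ)

theorem summable_coherentCoeff (f : BosonicFactor) (α : ℂ) :
    Summable fun n : ℕ => ‖coherentCoeff f α n‖ ^ 2 := by
  have h := (f.summable_norm (‖α‖ ^ 2)).mul_right
    ((Real.sqrt (normalization f α) ^ 2)⁻¹)
  refine h.congr fun n => ?_
  simp only [coherentCoeff, norm_div, norm_mul, norm_pow, Complex.norm_natCast,
    Complex.norm_real, Real.norm_eq_abs, div_pow, mul_pow, sq_abs]
  ring

theorem memlp_coherent {M : ℕ} (f : BosonicFactor) (α : Fin M → ℂ) :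
    Memℓp (fun n : Fin M → ℕ => ∏ j, coherentCoeff f (α j) (n j)) 2 := by
  have key : Summable fun n : Fin M → ℕ => ∏ j, ‖coherentCoeff f (α j) (n j)‖ ^ 2 := by
    have h0 : ∀ n : Fin M → ℕ, 0 ≤ ∏ j, ‖coherentCoeff f (α j) (n j)‖ ^ 2 :=
      fun n => Finset.prod_nonneg fun j _ => sq_nonneg _
    refine summable_of_sum_le (c := ∏ j, ∑' k, ‖coherentCoeff f (α j) k‖ ^ 2) h0 fun u => ?_
    have h1 : ∑ n ∈ u, ∏ j, ‖coherentCoeff f (α j) (n j)‖ ^ 2 ≤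
        ∑ n ∈ Fintype.piFinset fun j => u.image fun n => n j,
          ∏ j, ‖coherentCoeff f (α j) (n j)‖ ^ 2 :=
      Finset.sum_le_sum_of_subset_of_nonneg
        (fun n hn => Fintype.mem_piFinset.2 fun j => Finset.mem_image_of_mem (fun n => n j) hn)
        fun n _ _ => h0 n
    rw [← Finset.prod_univ_sum (fun j => u.image fun n => n j)
      (fun j k => ‖coherentCoeff f (α j) k‖ ^ 2)] at h1
    exact h1.trans (Finset.prod_le_prod (fun j _ => Finset.sum_nonneg fun k _ => sq_nonneg _)
      fun j _ => (summable_coherentCoeff f (α j)).sum_le_tsum _ fun k _ => sq_nonneg _)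
  apply memℓp_gen
  refine key.congr fun n => ?_
  rw [norm_prod, ENNReal.toReal_ofNat, Real.rpow_ofNat, Finset.prod_pow]

/-- The generalized coherent state `|α⟩ = |α_1⟩ ⊗ ⋯ ⊗ |α_M⟩`, where
`|α_j⟩ = N(α_j)^(-1/2) ∑ₙ (α_jⁿ / n!) f(n) |n⟩`. -/
def coherentKet {M : ℕ} (f : BosonicFactor) (α : Fin M → ℂ) : FockSpace M :=
  ⟨fun n => ∏ j, coherentCoeff f (α j) (n j), memlp_coherent f α⟩

/-- `⟨n|ρ|n⟩ = tr(ρ |n⟩⟨n|)`, the probability of the outcome `n` of a measurement of the state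
`ρ` in the Fock basis. -/
def outcomeProb {M : ℕ} (ρ : FockSpace M →L[ℂ] FockSpace M) (n : Fin M → ℕ) : ℝ :=
  (inner ℂ (fockKet n) (ρ (fockKet n))).re

/-- Density operators: positive operators of trace one. -/
structure IsDensityOperator {M : ℕ} (ρ : FockSpace M →L[ℂ] FockSpace M) : Prop where
  isPositive : ρ.IsPositive
  hasSum_trace : HasSum (fun n : Fin M → ℕ => outcomeProb ρ n) 1

/-- The `Q`-function `Q_ρ(α) = κ^(-M) ⟨α|ρ|α⟩`. -/
def qFunction {M : ℕ} (f : BosonicFactor) (κ : ℝ) (ρ : FockSpace M →L[ℂ] FockSpace M)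
    (α : Fin M → ℂ) : ℝ :=
  (κ ^ M)⁻¹ * (inner ℂ (coherentKet f α) (ρ (coherentKet f α))).re

/-- The vector `(α_1, …, α_M, α_1^*, …, α_M^*)`. -/
def phaseVec {M : ℕ} (α : Fin M → ℂ) : Fin M ⊕ Fin M → ℂ :=
  Sum.elim α (star α)

/-- Invertible covariance matrices of a random vector of the form
`v = (α_1, …, α_M, α_1^*, …, α_M^*)`: as `σ i j = 𝔼[v i * star (v j)]`, conjugating an entry
amounts to exchanging `α` and `α^*`. -/
structure IsCovariance {M : ℕ} (σ : Matrix (Fin M ⊕ Fin M) (Fin M ⊕ Fin M) ℂ) : Prop where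
  posDef : σ.PosDef
  map_swap : ∀ i j, σ i.swap j.swap = star (σ i j)

/-- The (real) number `w† σ⁻¹ w` for `w = (α, α^*)`. -/
def invQuadForm {M : ℕ} (σ : Matrix (Fin M ⊕ Fin M) (Fin M ⊕ Fin M) ℂ) (α : Fin M → ℂ) : ℝ :=
  (star (phaseVec α) ⬝ᵥ (σ⁻¹ *ᵥ phaseVec α)).re

/-- `ρ` is a generalized Gaussian state with covariance matrix `σ` and displacement `δ`, where
`g` is the constant that normalizes the `Q`-function. -/
structure HasGaussianQ {M : ℕ} (f : BosonicFactor) (κ : ℝ) (ρ : FockSpace M →L[ℂ] FockSpace M)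
    (σ : Matrix (Fin M ⊕ Fin M) (Fin M ⊕ Fin M) ℂ) (δ : Fin M → ℂ) (g : ℝ) : Prop where
  eq_gaussian : ∀ α : Fin M → ℂ, qFunction f κ ρ α =
    1 / (g * Real.sqrt σ.det.re) * Real.exp (-(1 / 2) * invQuadForm σ (α - δ))
  integral_eq_one : ∫ α : Fin M → ℂ, qFunction f κ ρ α = 1

/-- The Hafnian `Haf(A) = (2^k k!)⁻¹ ∑ ∏ᵢ A (e (inl i)) (e (inr i))`, the sum being over all ways
`e` of arranging the index set in `k` ordered pairs.  For symmetric `A` this is the sum over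
the perfect matchings of the index set; it is `0` if the number of indices is odd. -/
def hafnian {ι : Type*} [Fintype ι] [DecidableEq ι] (A : Matrix ι ι ℂ) : ℂ :=
  ((2 : ℂ) ^ (Fintype.card ι / 2) * ((Fintype.card ι / 2).factorial : ℂ))⁻¹ *
    ∑ e : Fin (Fintype.card ι / 2) ⊕ Fin (Fintype.card ι / 2) ≃ ι,
      ∏ i, A (e (Sum.inl i)) (e (Sum.inr i))

/-- The Hafnian of the submatrix of `A` with rows and columns in `B`. -/
def hafnianOn {ι : Type*} [DecidableEq ι] (A : Matrix ι ι ℂ) (B : Finset ι) : ℂ :=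
  hafnian (A.submatrix (Subtype.val : {i // i ∈ B} → ι) (Subtype.val : {i // i ∈ B} → ι))

/-- The matrix `[[0, I_M], [I_M, 0]] (c_1 I_{2M} - σ⁻¹)`. -/
def gbsMatrix {M : ℕ} (f : BosonicFactor) (σ : Matrix (Fin M ⊕ Fin M) (Fin M ⊕ Fin M) ℂ) :
    Matrix (Fin M ⊕ Fin M) (Fin M ⊕ Fin M) ℂ :=
  Matrix.fromBlocks 0 1 1 0 * ((logCoeff f 1 : ℂ) • 1 - σ⁻¹)

/-- The linear coefficients `F = d† σ⁻¹`, where `d = (δ, δ^*)`. -/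
def linearCoeff {M : ℕ} (σ : Matrix (Fin M ⊕ Fin M) (Fin M ⊕ Fin M) ℂ) (δ : Fin M → ℂ) :
    Fin M ⊕ Fin M → ℂ :=
  star (phaseVec δ) ᵥ* σ⁻¹

/-- The indices `j` and `M + j` of the modes `j` with `n_j ≠ 0`. -/
def clickSet {M : ℕ} (n : Fin M → ℕ) : Finset (Fin M ⊕ Fin M) :=
  Finset.univ.filter fun i => Sum.elim n n i ≠ 0

end GenBoson

end

/-!
The unnormalized coherent state `K(α) = ∑ₙ αⁿ f(n) / n! |n⟩` depends on `α` through a power series,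
so `⟨K(α)|ρ|K(α)⟩` is a power series in `α` and `α^*` in which `∏ⱼ (αⱼ αⱼ^*)^(nⱼ)` has the
coefficient `⟨n|ρ|n⟩ ∏ⱼ |f(nⱼ)|² / nⱼ!²` (`coeff_matrixElementPoly`). On the other hand
`⟨K(α)|ρ|K(α)⟩ = κ^M ∏ⱼ N(αⱼ) Q(α)`, and if `Q` is Gaussian then, with `v = (α, α^*)`, this is a
constant times `∏ⱼ (N(αⱼ) exp (-c₁ |αⱼ|²)) * exp (F v) * exp (½ vᵀ A v)`
(`IsCovariance.exponent_eq`, where the symmetry `σ (swap i) (swap j) = star (σ i j)` makes the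
bilinear form of `σ⁻¹` symmetric). The outcome probability is found by comparing coefficients.

For `nⱼ ∈ {0, 1}` the monomial in question is square-free in the `2M` variables `v`. Modulo squares
of the variables the first product is `1`, since `N(x) exp (-c₁ x) = 1 + O(x²)` in `x = |α|²`
(`exists_taylor_normSeries_mul_exp`, `coeff_sqfreeExponent_prod_mul`). The square-free coefficients
of `exp (F v)` are the products of entries of `F` (`coeff_expTrunc_linearPoly`), those of
`exp (½ vᵀ A v)` are the Hafnians of the submatrices of `A` (`coeff_expTrunc_quadraticPoly`), and
those of a product are subset convolutions (`coeff_sqfreeExponent_mul`), which gives the sum over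
`B ⊆ S`.

Power series in `α` and `α^*` are handled through their Taylor polynomials: `RayExpansion N G p`
says that `G` agrees with the polynomial `p` in `α` and `α^*` to order `N` along every real ray.
Such a `p` is unique up to degree `N` (`RayExpansion.coeff_eq`), because `α` and `α^*` are
algebraically independent (`eq_zero_of_eval_phaseVec_eq_zero`).
-/

open scoped Matrix ComplexOrder

namespace GenBoson

open MvPolynomial

/-! ### Square-free coefficients of polynomials -/

section SquareFree

variable {ι : Type*} [DecidableEq ι]

/-- The exponent of the square-free monomial `∏ i ∈ U, X i`. -/
noncomputable def sqfreeExponent (U : Finset ι) : ι →₀ ℕ :=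
  ∑ i ∈ U, Finsupp.single i 1

lemma sqfreeExponent_apply (U : Finset ι) (i : ι) :
    sqfreeExponent U i = if i ∈ U then 1 else 0 := by
  simp [sqfreeExponent, Finsupp.finsetSum_apply, Finsupp.single_apply]

lemma support_sqfreeExponent (U : Finset ι) : (sqfreeExponent U).support = U := by
  ext i; simp [sqfreeExponent_apply]

lemma degree_sqfreeExponent {ι : Type*} (U : Finset ι) : (sqfreeExponent U).degree = U.card := by
  simp [sqfreeExponent]

lemma eq_sqfreeExponent_support {m : ι →₀ ℕ} (hm : ∀ i, m i ≤ 1) :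
    m = sqfreeExponent m.support := by
  ext i
  have := hm i
  by_cases h : m i = 0 <;> simp [sqfreeExponent_apply, h]
  omega

/-- On square-free coefficients, multiplication of polynomials is the subset convolution. -/
lemma coeff_sqfreeExponent_mul (U : Finset ι) (p q : MvPolynomial ι ℂ) :
    coeff (sqfreeExponent U) (p * q) =
      ∑ B ∈ U.powerset, coeff (sqfreeExponent B) p * coeff (sqfreeExponent (U \ B)) q := by
  rw [coeff_mul]
  symm
  have key : ∀ x : (ι →₀ ℕ) × (ι →₀ ℕ),
      x ∈ Finset.HasAntidiagonal.antidiagonal (sqfreeExponent U) →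
      x.1.support ⊆ U ∧ sqfreeExponent x.1.support = x.1 ∧
        sqfreeExponent (U \ x.1.support) = x.2 := by
    intro x hx
    rw [Finset.HasAntidiagonal.mem_antidiagonal] at hx
    have hx' : ∀ i, x.1 i + x.2 i = if i ∈ U then 1 else 0 := fun i => by
      rw [← sqfreeExponent_apply, ← hx, Finsupp.add_apply]
    refine ⟨fun i hi => ?_, ?_, ?_⟩
    · by_contra h
      have := hx' i
      simp [h] at this
      simp [this.1] at hi
    · refine (eq_sqfreeExponent_support fun i => ?_).symm
      have := hx' i
      split_ifs at this <;> omega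
    · ext i
      have := hx' i
      by_cases h : i ∈ U <;> by_cases h0 : x.1 i = 0 <;>
        simp [sqfreeExponent_apply, h, h0] at this ⊢ <;> omega
  refine Finset.sum_nbij' (fun B => (sqfreeExponent B, sqfreeExponent (U \ B)))
    (fun x => x.1.support) ?_ ?_ ?_ ?_ ?_
  · intro B hB
    rw [Finset.mem_powerset] at hB
    rw [Finset.HasAntidiagonal.mem_antidiagonal]
    simp only [sqfreeExponent]
    rw [add_comm]
    exact Finset.sum_sdiff hB
  · intro x hx
    exact Finset.mem_powerset.2 (key x hx).1
  · intro B _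
    exact support_sqfreeExponent B
  · intro x hx
    exact Prod.ext (key x hx).2.1 (key x hx).2.2
  · intro B _
    rfl

/-- A factor that is `1` up to a multiple of a square `X i ^ 2` does not affect the square-free
coefficients. -/
lemma coeff_sqfreeExponent_prod_mul {κ : Type*} (s : Finset κ) (i : κ → ι)
    (r : κ → MvPolynomial ι ℂ) (U : Finset ι) (q : MvPolynomial ι ℂ) :
    coeff (sqfreeExponent U) ((∏ j ∈ s, (1 + X (i j) ^ 2 * r j)) * q) =
      coeff (sqfreeExponent U) q := by
  classical
  induction s using Finset.induction_on with
  | empty => simp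
  | insert j s hj ih =>
    rw [Finset.prod_insert hj, mul_assoc, add_mul, one_mul, coeff_add, ih, mul_assoc,
      X_pow_eq_monomial, coeff_monomial_mul', if_neg, add_zero]
    intro h
    have := h (i j)
    rw [sqfreeExponent_apply, Finsupp.single_eq_same] at this
    split_ifs at this <;> omega

lemma sum_single_eq_sqfreeExponent_iff {κ : Type*} [Fintype κ] (g : κ → ι) (U : Finset ι) :
    ∑ a, Finsupp.single (g a) 1 = sqfreeExponent U ↔
      Function.Injective g ∧ ∀ i, i ∈ U ↔ ∃ a, g a = i := by
  constructor
  · intro h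
    have h' : ∀ i, (Finset.univ.filter fun a => g a = i).card = if i ∈ U then 1 else 0 := by
      intro i
      rw [← sqfreeExponent_apply, ← h]
      simp [Finsupp.finsetSum_apply, Finsupp.single_apply]
    refine ⟨fun a b hab => ?_, fun i => ?_⟩
    · have h1 : (Finset.univ.filter fun x => g x = g b).card ≤ 1 := by
        rw [h']; split_ifs <;> omega
      exact Finset.card_le_one.1 h1 a (by simp [hab]) b (by simp)
    · have := h' i
      by_cases hi : i ∈ U
      · simp only [hi, if_true] at this
        obtain ⟨a, ha⟩ := Finset.card_pos.1 (by rw [this]; exact one_pos)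
        simp only [hi, true_iff]
        exact ⟨a, by simpa using ha⟩
      · simp only [hi, if_false, Finset.card_eq_zero] at this
        simp only [hi, false_iff]
        rintro ⟨a, ha⟩
        have : a ∈ (∅ : Finset κ) := this ▸ by simp [ha]
        simp at this
  · rintro ⟨hg, hU⟩
    have : U = Finset.univ.image g := by ext i; simp [hU]
    rw [this, sqfreeExponent, Finset.sum_image (fun a _ b _ h => hg h)]

/-- The words `g` whose monomial `∏ a, X (g a)` is `∏ i ∈ U, X i` are the enumerations of `U`. -/
lemma sum_ite_single_eq_sqfreeExponent [Fintype ι] {κ : Type*} [Fintype κ] [DecidableEq κ]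
    (U : Finset ι) (w : (κ → ι) → ℂ) :
    (∑ g : κ → ι, if ∑ a, Finsupp.single (g a) 1 = sqfreeExponent U then w g else 0) =
      ∑ e : κ ≃ {i // i ∈ U}, w fun a => (e a : ι) := by
  rw [← Finset.sum_filter]
  symm
  refine Finset.sum_nbij (fun (e : κ ≃ {i // i ∈ U}) a => (e a : ι)) ?_ ?_ ?_ ?_
  · intro e _
    simp only [Finset.mem_filter, Finset.mem_univ, true_and, sum_single_eq_sqfreeExponent_iff]
    refine ⟨fun a b h => e.injective (Subtype.ext h), fun i => ⟨fun hi => ?_, ?_⟩⟩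
    · exact ⟨e.symm ⟨i, hi⟩, by simp⟩
    · rintro ⟨a, rfl⟩
      exact (e a).2
  · intro e _ e' _ h
    ext a
    exact congrFun h a
  · intro g hg
    simp only [Finset.coe_filter, Finset.mem_univ, true_and, Set.mem_ofPred_eq,
      sum_single_eq_sqfreeExponent_iff] at hg
    refine ⟨Equiv.ofBijective (fun a => ⟨g a, (hg.2 _).2 ⟨a, rfl⟩⟩) ⟨fun a b h => ?_, ?_⟩,
      by simp, rfl⟩
    · exact hg.1 (by simpa using h)
    · rintro ⟨i, hi⟩
      obtain ⟨a, rfl⟩ := (hg.2 i).1 hi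
      exact ⟨a, rfl⟩
  · intro e _
    rfl

/-- The Taylor polynomial of `exp ∘ q` of order `N`, when `q` has no constant term. -/
noncomputable def expTrunc (N : ℕ) (q : MvPolynomial ι ℂ) : MvPolynomial ι ℂ :=
  ∑ k ∈ Finset.range (N + 1), C ((k.factorial : ℂ)⁻¹) * q ^ k

variable [Fintype ι]

/-- The linear form `∑ i, F i * X i`. -/
noncomputable def linearPoly (F : ι → ℂ) : MvPolynomial ι ℂ :=
  ∑ i, C (F i) * X i

/-- The quadratic form `½ ∑ i j, A i j * X i * X j`. -/
noncomputable def quadraticPoly (A : Matrix ι ι ℂ) : MvPolynomial ι ℂ :=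
  ∑ p : ι × ι, C (A p.1 p.2 / 2) * (X p.1 * X p.2)

lemma coeff_linearPoly_pow (F : ι → ℂ) (U : Finset ι) (k : ℕ) :
    coeff (sqfreeExponent U) (linearPoly F ^ k) =
      ∑ e : Fin k ≃ {i // i ∈ U}, ∏ a, F (e a) := by
  rw [linearPoly, Fintype.sum_pow, coeff_sum,
    ← sum_ite_single_eq_sqfreeExponent U (fun g : Fin k → ι => ∏ a, F (g a))]
  refine Finset.sum_congr rfl fun g _ => ?_
  have : ∏ a, (C (F (g a)) * X (g a) : MvPolynomial ι ℂ) =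
      monomial (∑ a, Finsupp.single (g a) 1) (∏ a, F (g a)) := by
    rw [monomial_sum_index, Finset.prod_mul_distrib, map_prod]
    rfl
  rw [this, coeff_monomial]

lemma coeff_quadraticPoly_pow (A : Matrix ι ι ℂ) (U : Finset ι) (k : ℕ) :
    coeff (sqfreeExponent U) (quadraticPoly A ^ k) =
      (2 ^ k : ℂ)⁻¹ *
        ∑ e : Fin k ⊕ Fin k ≃ {i // i ∈ U}, ∏ a, A (e (Sum.inl a)) (e (Sum.inr a)) := by
  rw [quadraticPoly, Fintype.sum_pow, coeff_sum,
    ← sum_ite_single_eq_sqfreeExponent U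
      (fun g : Fin k ⊕ Fin k → ι => ∏ a, A (g (Sum.inl a)) (g (Sum.inr a))), Finset.mul_sum]
  let E : (Fin k → ι × ι) ≃ (Fin k ⊕ Fin k → ι) :=
    (Equiv.arrowProdEquivProdArrow (Fin k) (fun _ => ι) (fun _ => ι)).trans
      (Equiv.sumArrowEquivProdArrow (Fin k) (Fin k) ι).symm
  refine Fintype.sum_equiv E _ _ fun p => ?_
  have h1 : ∏ a, (C (A (p a).1 (p a).2 / 2) * (X (p a).1 * X (p a).2) : MvPolynomial ι ℂ) =
      monomial (∑ a, Finsupp.single (E p a) 1) (∏ a, (A (p a).1 (p a).2 / 2)) := by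
    simp only [monomial_sum_index, Finset.prod_mul_distrib, map_prod, Fintype.prod_sum_type]
    rfl
  have h2 : ∏ a, (A (p a).1 (p a).2 / 2) =
      (2 ^ k : ℂ)⁻¹ * ∏ a, A (E p (Sum.inl a)) (E p (Sum.inr a)) := by
    rw [Finset.prod_div_distrib, Finset.prod_const, Finset.card_univ, Fintype.card_fin,
      div_eq_inv_mul]
    rfl
  rw [h1, coeff_monomial, h2, mul_ite, mul_zero]

lemma coeff_expTrunc_linearPoly (N : ℕ) (F : ι → ℂ) (U : Finset ι) (hU : U.card ≤ N) :
    coeff (sqfreeExponent U) (expTrunc N (linearPoly F)) = ∏ i ∈ U, F i := by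
  rw [expTrunc, coeff_sum, Finset.sum_eq_single U.card]
  · rw [coeff_C_mul, coeff_linearPoly_pow]
    have h : ∀ e : Fin U.card ≃ {i // i ∈ U}, ∏ a, F (e a) = ∏ i ∈ U, F i := fun e => by
      rw [Equiv.prod_comp e fun i => F i, Finset.prod_coe_sort]
    rw [Finset.sum_congr rfl fun e _ => h e, Finset.sum_const, Finset.card_univ,
      Fintype.card_equiv U.equivFin.symm, Fintype.card_fin, nsmul_eq_mul,
      inv_mul_cancel_left₀ (Nat.cast_ne_zero.2 (Nat.factorial_ne_zero _))]
  · intro k _ hk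
    have : IsEmpty (Fin k ≃ {i // i ∈ U}) :=
      ⟨fun e => hk (by simpa using Fintype.card_congr e)⟩
    rw [coeff_C_mul, coeff_linearPoly_pow, Finset.univ_eq_empty, Finset.sum_empty, mul_zero]
  · intro h
    simp at h
    omega

/-- Hafnians are the square-free Taylor coefficients of a Gaussian. -/
lemma coeff_expTrunc_quadraticPoly (N : ℕ) (A : Matrix ι ι ℂ) (U : Finset ι) (hU : U.card ≤ N) :
    coeff (sqfreeExponent U) (expTrunc N (quadraticPoly A)) = hafnianOn A U := by
  rw [expTrunc, coeff_sum, Finset.sum_eq_single (Fintype.card {i // i ∈ U} / 2)]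
  · rw [coeff_C_mul, coeff_quadraticPoly_pow, ← mul_assoc, ← mul_inv, mul_comm (Nat.cast _)]
    rfl
  · intro k _ hk
    have : IsEmpty (Fin k ⊕ Fin k ≃ {i // i ∈ U}) :=
      ⟨fun e => hk (by
        rw [← Fintype.card_congr e, Fintype.card_sum, Fintype.card_fin]; omega)⟩
    rw [coeff_C_mul, coeff_quadraticPoly_pow, Finset.univ_eq_empty, Finset.sum_empty, mul_zero,
      mul_zero]
  · intro h
    simp at h
    omega

end SquareFree

/-! ### Taylor expansions in `α` and `α^*` along rays -/

section RayExpansion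

open Asymptotics Filter Topology

variable {M : ℕ}

lemma phaseVec_smul (r : ℝ) (α : Fin M → ℂ) : phaseVec (r • α) = (r : ℂ) • phaseVec α := by
  ext i
  cases i <;> simp [phaseVec]

lemma eval_smul_of_isHomogeneous {ι : Type*} {p : MvPolynomial ι ℂ} {k : ℕ}
    (hp : p.IsHomogeneous k) (c : ℂ) (v : ι → ℂ) : eval (c • v) p = c ^ k * eval v p := by
  rw [eval_eq, eval_eq, Finset.mul_sum]
  refine Finset.sum_congr rfl fun d hd => ?_
  have hk : ∑ i ∈ d.support, d i = k := by
    rw [← Finsupp.degree_apply, ← hp (mem_support_iff.1 hd), Finsupp.degree_eq_weight_one]; rfl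
  simp only [Pi.smul_apply, smul_eq_mul, mul_pow, Finset.prod_mul_distrib,
    Finset.prod_pow_eq_pow_sum, hk]
  ring

/-- `α` and `α^*` are algebraically independent: a polynomial is determined by its values at the
vectors `(α, α^*)`. -/
lemma eq_zero_of_eval_phaseVec_eq_zero {p : MvPolynomial (Fin M ⊕ Fin M) ℂ}
    (hp : ∀ α, eval (phaseVec α) p = 0) : p = 0 := by
  -- substitute `α = x + i y`, `α^* = x - i y`
  let q : MvPolynomial (Fin M ⊕ Fin M) ℂ := bind₁ (Sum.elim
    (fun j => X (Sum.inl j) + C Complex.I * X (Sum.inr j))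
    (fun j => X (Sum.inl j) - C Complex.I * X (Sum.inr j))) p
  have heval : ∀ w : Fin M ⊕ Fin M → ℂ, eval w q = eval (Sum.elim
      (fun j => w (Sum.inl j) + Complex.I * w (Sum.inr j))
      (fun j => w (Sum.inl j) - Complex.I * w (Sum.inr j))) p := by
    intro w
    have h := aeval_bind₁ (R := ℂ) w (Sum.elim
      (fun j => X (Sum.inl j) + C Complex.I * X (Sum.inr j))
      (fun j => X (Sum.inl j) - C Complex.I * X (Sum.inr j))) p
    rw [aeval_eq_eval, aeval_eq_eval] at h
    refine h.trans ?_
    congr 2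
    ext i
    cases i <;> simp
  have hq : q = 0 := by
    refine funext_set (fun _ => Set.range ((↑) : ℝ → ℂ))
      (fun _ => Set.infinite_range_of_injective Complex.ofReal_injective) fun w hw => ?_
    have hw' : ∀ i, ∃ x : ℝ, (x : ℂ) = w i := fun i => hw i trivial
    choose x hx using hw'
    rw [heval, map_zero, ← hp fun j => (x (Sum.inl j) : ℂ) + Complex.I * x (Sum.inr j)]
    congr 2
    ext i
    cases i <;> simp [phaseVec, ← hx, sub_eq_add_neg]
  refine MvPolynomial.funext fun z => ?_
  have h := heval (Sum.elim (fun j => (z (Sum.inl j) + z (Sum.inr j)) / 2)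
    (fun j => (z (Sum.inl j) - z (Sum.inr j)) / (2 * Complex.I)))
  rw [hq, map_zero] at h
  rw [map_zero, h]
  congr 2
  ext i
  cases i <;>
    · simp only [Sum.elim_inl, Sum.elim_inr]
      field_simp [Complex.I_ne_zero]
      ring

lemma coeff_eq_zero_of_isBigO (n : ℕ) (p : Polynomial ℂ)
    (hp : (fun r : ℝ => p.eval (r : ℂ)) =O[𝓝[≠] 0] fun r : ℝ => r ^ n) :
    ∀ k < n, p.coeff k = 0 := by
  induction n generalizing p with
  | zero => intro k hk; omega
  | succ n ih =>
    have hcont : Continuous fun r : ℝ => p.eval (r : ℂ) :=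
      p.continuous.comp Complex.continuous_ofReal
    have h0 : p.coeff 0 = 0 := by
      have hlim : Tendsto (fun r : ℝ => r ^ (n + 1)) (𝓝[≠] 0) (𝓝 0) := by
        have : Tendsto (fun r : ℝ => r ^ (n + 1)) (𝓝 0) (𝓝 ((0 : ℝ) ^ (n + 1))) :=
          (continuous_pow (n + 1)).tendsto 0
        rw [zero_pow n.succ_ne_zero] at this
        exact this.mono_left nhdsWithin_le_nhds
      have h1 := hp.trans_tendsto hlim
      have h2 := (hcont.tendsto 0).mono_left (nhdsWithin_le_nhds (s := {0}ᶜ))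
      have := tendsto_nhds_unique h2 h1
      rwa [Complex.ofReal_zero, ← Polynomial.coeff_zero_eq_eval_zero] at this
    have hdiv : (fun r : ℝ => p.divX.eval (r : ℂ)) =O[𝓝[≠] 0] fun r : ℝ => r ^ n := by
      have hinv : (fun r : ℝ => ((r : ℂ))⁻¹) =O[𝓝[≠] 0] fun r : ℝ => r⁻¹ :=
        IsBigO.of_bound 1 (Eventually.of_forall fun r => by simp)
      refine (hp.mul hinv).congr' ?_ ?_
      · filter_upwards [self_mem_nhdsWithin] with r hr
        have hr' : (r : ℂ) ≠ 0 := Complex.ofReal_ne_zero.2 hr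
        conv_lhs => rw [← Polynomial.divX_mul_X_add p]
        simp [h0, hr']
      · filter_upwards [self_mem_nhdsWithin] with r hr
        have hr' : r ≠ 0 := hr
        rw [pow_succ, mul_inv_cancel_right₀ hr']
    intro k hk
    cases k with
    | zero => exact h0
    | succ k => rw [← Polynomial.coeff_divX]; exact ih _ hdiv k (by omega)

/-- `p` is the Taylor polynomial of order `N` of `G` in the variables `α` and `α^*`, in the sense
that on every ray `r ↦ r α` it approximates `G` up to an error `O(r ^ (N + 1))`. -/
def RayExpansion (N : ℕ) (G : (Fin M → ℂ) → ℂ) (p : MvPolynomial (Fin M ⊕ Fin M) ℂ) : Prop :=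
  ∀ α : Fin M → ℂ,
    (fun r : ℝ => G (r • α) - eval (phaseVec (r • α)) p) =O[𝓝 0] fun r : ℝ => r ^ (N + 1)

lemma eval_phaseVec_isBigO_one (p : MvPolynomial (Fin M ⊕ Fin M) ℂ) (α : Fin M → ℂ) :
    (fun r : ℝ => eval (phaseVec (r • α)) p) =O[𝓝 0] fun _ => (1 : ℝ) := by
  simp_rw [phaseVec_smul]
  have : Continuous fun r : ℝ => eval ((r : ℂ) • phaseVec α) p :=
    (continuous_eval p).comp (Complex.continuous_ofReal.smul continuous_const)
  exact (this.tendsto 0).isBigO_one ℝ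

lemma pow_isBigO_one (n : ℕ) : (fun r : ℝ => r ^ n) =O[𝓝 0] fun _ => (1 : ℝ) :=
  ((continuous_pow n).tendsto 0).isBigO_one ℝ

lemma RayExpansion.mul {N : ℕ} {G H : (Fin M → ℂ) → ℂ} {p q : MvPolynomial (Fin M ⊕ Fin M) ℂ}
    (hG : RayExpansion N G p) (hH : RayExpansion N H q) :
    RayExpansion N (fun α => G α * H α) (p * q) := by
  intro α
  have hH1 : (fun r : ℝ => H (r • α)) =O[𝓝 0] fun _ => (1 : ℝ) := by
    refine (((hH α).trans (pow_isBigO_one _)).add (eval_phaseVec_isBigO_one q α)).congr_left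
      fun r => by ring
  refine (((hG α).mul hH1).add ((hH α).mul (eval_phaseVec_isBigO_one p α))).congr
    (fun r => ?_) fun r => mul_one _
  rw [map_mul]
  ring

lemma rayExpansion_C (N : ℕ) (c : ℂ) : RayExpansion (M := M) N (fun _ => c) (C c) := fun α => by
  simpa using isBigO_zero _ _

lemma RayExpansion.prod {N : ℕ} {κ : Type*} (s : Finset κ) {G : κ → (Fin M → ℂ) → ℂ}
    {p : κ → MvPolynomial (Fin M ⊕ Fin M) ℂ} (h : ∀ j ∈ s, RayExpansion N (G j) (p j)) :
    RayExpansion N (fun α => ∏ j ∈ s, G j α) (∏ j ∈ s, p j) := by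
  classical
  induction s using Finset.induction_on with
  | empty => simpa using rayExpansion_C N 1
  | insert j s hj ih =>
    simp only [Finset.prod_insert hj]
    exact (h j (Finset.mem_insert_self j s)).mul
      (ih fun i hi => h i (Finset.mem_insert_of_mem hi))

/-- Taylor polynomials are unique. -/
lemma RayExpansion.coeff_eq {N : ℕ} {G : (Fin M → ℂ) → ℂ}
    {p q : MvPolynomial (Fin M ⊕ Fin M) ℂ} (hp : RayExpansion N G p) (hq : RayExpansion N G q)
    {m : Fin M ⊕ Fin M →₀ ℕ} (hm : m.degree ≤ N) : coeff m p = coeff m q := by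
  rw [← sub_eq_zero, ← coeff_sub]
  set P := p - q with hP
  have hO : ∀ α : Fin M → ℂ,
      (fun r : ℝ => eval (phaseVec (r • α)) P) =O[𝓝 0] fun r : ℝ => r ^ (N + 1) := fun α =>
    ((hq α).sub (hp α)).congr_left fun r => by rw [hP, map_sub]; ring
  have hcomp : homogeneousComponent m.degree P = 0 := by
    refine eq_zero_of_eval_phaseVec_eq_zero fun α => ?_
    -- the restriction of `P` to the ray of `α`, as a polynomial in the parameter of the ray
    let u : Polynomial ℂ := ∑ k ∈ Finset.range (P.totalDegree + 1),
      Polynomial.C (eval (phaseVec α) (homogeneousComponent k P)) * Polynomial.X ^ k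
    have hu : ∀ r : ℝ, u.eval (r : ℂ) = eval (phaseVec (r • α)) P := fun r => by
      conv_rhs => rw [← sum_homogeneousComponent P]
      rw [map_sum, Polynomial.eval_finsetSum]
      refine Finset.sum_congr rfl fun k _ => ?_
      rw [phaseVec_smul, eval_smul_of_isHomogeneous (homogeneousComponent_isHomogeneous k P)]
      rw [Polynomial.eval_mul, Polynomial.eval_C, Polynomial.eval_pow, Polynomial.eval_X, mul_comm]
    have h0 := coeff_eq_zero_of_isBigO (N + 1) u
      (((hO α).congr_left fun r => (hu r).symm).mono nhdsWithin_le_nhds) m.degree (by omega)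
    by_cases hd : P.totalDegree < m.degree
    · rw [homogeneousComponent_eq_zero _ _ hd, map_zero]
    · simp only [u, Polynomial.finsetSum_coeff, Polynomial.coeff_C_mul_X_pow] at h0
      rwa [Finset.sum_ite_eq, if_pos (Finset.mem_range.2 (by omega))] at h0
  have := congrArg (coeff m) hcomp
  rwa [coeff_homogeneousComponent, if_pos rfl, coeff_zero] at this

lemma rayExpansion_exp (N : ℕ) {q : MvPolynomial (Fin M ⊕ Fin M) ℂ} {k : ℕ}
    (hq : q.IsHomogeneous k) (hk : 0 < k) :
    RayExpansion N (fun α => Complex.exp (eval (phaseVec α) q)) (expTrunc N q) := by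
  intro α
  have hlin : (fun r : ℝ => eval (phaseVec (r • α)) q) =O[𝓝 0] fun r : ℝ => r := by
    have h1 : (fun r : ℝ => (r : ℂ)) =O[𝓝 0] fun r : ℝ => r :=
      IsBigO.of_bound 1 (Eventually.of_forall fun r => by simp)
    obtain ⟨k, rfl⟩ := Nat.exists_eq_succ_of_ne_zero hk.ne'
    have h2 : (fun r : ℝ => (r : ℂ) ^ k * eval (phaseVec α) q) =O[𝓝 0] fun _ => (1 : ℝ) := by
      have : Continuous fun r : ℝ => (r : ℂ) ^ k * eval (phaseVec α) q := by fun_prop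
      exact (this.tendsto 0).isBigO_one ℝ
    refine (h1.mul h2).congr (fun r => ?_) fun r => mul_one r
    rw [phaseVec_smul, eval_smul_of_isHomogeneous hq, pow_succ]
    ring
  have h := (Complex.exp_sub_sum_range_isBigO_pow (N + 1)).comp_tendsto
    (hlin.trans_tendsto tendsto_id)
  refine (h.trans (hlin.pow (N + 1))).congr_left fun r => ?_
  simp [expTrunc, div_eq_inv_mul]

lemma isHomogeneous_linearPoly {ι : Type*} [Fintype ι] (F : ι → ℂ) :
    (linearPoly F).IsHomogeneous 1 :=
  IsHomogeneous.sum _ _ _ fun i _ => by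
    simpa using (isHomogeneous_C _ (F i)).mul (isHomogeneous_X ℂ i)

lemma isHomogeneous_quadraticPoly {ι : Type*} [Fintype ι] (A : Matrix ι ι ℂ) :
    (quadraticPoly A).IsHomogeneous 2 :=
  IsHomogeneous.sum _ _ _ fun p _ => by
    simpa using (isHomogeneous_C _ (A p.1 p.2 / 2)).mul
      ((isHomogeneous_X ℂ p.1).mul (isHomogeneous_X ℂ p.2))

/-- The expansion of a function of `|α_j|²`, with `|α_j|²` written as `α_j α_j^*`. -/
lemma rayExpansion_normSq {N : ℕ} {h : ℝ → ℂ} {T : Polynomial ℂ}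
    (hT : (fun x : ℝ => h x - T.eval (x : ℂ)) =O[𝓝 0] fun x : ℝ => x ^ (N + 1)) (j : Fin M) :
    RayExpansion N (fun α => h (‖α j‖ ^ 2))
      (Polynomial.aeval (X (Sum.inl j) * X (Sum.inr j)) T) := by
  intro α
  have hlim : Tendsto (fun r : ℝ => ‖(r • α) j‖ ^ 2) (𝓝 0) (𝓝 0) := by
    have : Continuous fun r : ℝ => ‖(r • α) j‖ ^ 2 := by
      simp only [Pi.smul_apply]; fun_prop
    simpa using this.tendsto 0
  have hsq : (fun r : ℝ => ‖(r • α) j‖ ^ 2) =O[𝓝 0] fun r : ℝ => r := by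
    have h1 : (fun r : ℝ => r * ‖α j‖ ^ 2) =O[𝓝 0] fun _ => (1 : ℝ) := by
      have : Continuous fun r : ℝ => r * ‖α j‖ ^ 2 := by fun_prop
      exact (this.tendsto 0).isBigO_one ℝ
    refine ((isBigO_refl (fun r : ℝ => r) (𝓝 0)).mul h1).congr (fun r => ?_) fun r => mul_one r
    rw [Pi.smul_apply, norm_smul, mul_pow, Real.norm_eq_abs, sq_abs]
    ring
  refine ((hT.comp_tendsto hlim).trans (hsq.pow (N + 1))).congr_left fun r => ?_
  simp only [Function.comp_apply]
  congr 1
  have hmul : eval (phaseVec (r • α)) (X (Sum.inl j) * X (Sum.inr j)) =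
      ((‖(r • α) j‖ ^ 2 : ℝ) : ℂ) := by
    rw [map_mul, eval_X, eval_X, Complex.ofReal_pow, ← Complex.mul_conj']
    rfl
  have hid : (eval (phaseVec (r • α))).comp
      (algebraMap ℂ (MvPolynomial (Fin M ⊕ Fin M) ℂ)) = RingHom.id ℂ :=
    RingHom.ext fun a => eval_C a
  rw [← hmul, Polynomial.aeval_def, Polynomial.hom_eval₂, hid]
  rfl

end RayExpansion

/-! ### The normalization of the coherent states -/

section Normalization

open Asymptotics Filter Topology

variable (f : BosonicFactor)

lemma abs_normSeries_sub_sum_le (N : ℕ) {x : ℝ} (hx : |x| ≤ 1) :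
    |normSeries f x - ∑ k ∈ Finset.range N, ‖f.toFun k‖ ^ 2 / (k.factorial : ℝ) ^ 2 * x ^ k| ≤
      normSeries f 1 * |x| ^ N := by
  set a : ℕ → ℝ := fun k => ‖f.toFun k‖ ^ 2 / (k.factorial : ℝ) ^ 2 with ha
  have ha0 : ∀ k, 0 ≤ a k := fun k => by positivity
  have hs1 : Summable fun k => a k * 1 ^ k := f.summable_norm 1
  have hs1' : Summable fun k => a (k + N) * 1 ^ (k + N) := (summable_nat_add_iff N).2 hs1
  have htail : normSeries f x - ∑ k ∈ Finset.range N, a k * x ^ k =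
      ∑' k, a (k + N) * x ^ (k + N) :=
    sub_eq_of_eq_add' (Summable.sum_add_tsum_nat_add N (f.summable_norm x)).symm
  have hle : ∑' k, a (k + N) * 1 ^ (k + N) ≤ normSeries f 1 := by
    rw [normSeries, ← Summable.sum_add_tsum_nat_add N hs1]
    exact le_add_of_nonneg_left (Finset.sum_nonneg fun k _ => mul_nonneg (ha0 k) (by simp))
  rw [htail, ← Real.norm_eq_abs]
  refine (tsum_of_norm_bounded (hs1'.hasSum.mul_right (|x| ^ N)) fun k => ?_).trans
    (mul_le_mul_of_nonneg_right hle (by positivity))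
  rw [norm_mul, Real.norm_of_nonneg (ha0 _), norm_pow, Real.norm_eq_abs, pow_add, one_pow, mul_one]
  exact mul_le_mul_of_nonneg_left
    (mul_le_of_le_one_left (by positivity) (pow_le_one₀ (abs_nonneg x) hx)) (ha0 _)

lemma normSeries_sub_sum_isBigO (N : ℕ) :
    (fun x : ℝ => normSeries f x -
      ∑ k ∈ Finset.range N, ‖f.toFun k‖ ^ 2 / (k.factorial : ℝ) ^ 2 * x ^ k) =O[𝓝 0]
      fun x : ℝ => x ^ N := by
  refine IsBigO.of_bound (normSeries f 1) ?_
  filter_upwards [Metric.closedBall_mem_nhds (0 : ℝ) one_pos] with x hx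
  rw [norm_pow, Real.norm_eq_abs, Real.norm_eq_abs]
  exact abs_normSeries_sub_sum_le f N (by simpa using hx)

lemma one_le_normSeries {x : ℝ} (hx : 0 ≤ x) : 1 ≤ normSeries f x := by
  have := (f.summable_norm x).le_tsum 0 fun k _ => by positivity
  simpa [normSeries, f.map_zero] using this

lemma normalization_pos (α : ℂ) : 0 < normalization f α :=
  zero_lt_one.trans_le (one_le_normSeries f (sq_nonneg _))

lemma normSeries_zero : normSeries f 0 = 1 := by
  rw [normSeries, tsum_eq_single 0 fun k hk => by simp [hk]]
  simp [f.map_zero]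

lemma hasDerivAt_normSeries_zero : HasDerivAt (normSeries f) (‖f.toFun 1‖ ^ 2) 0 := by
  rw [hasDerivAt_iff_isLittleO]
  have h : (fun x : ℝ => x ^ 2) =o[𝓝 0] fun x : ℝ => x := by
    simpa using isLittleO_pow_pow (𝕜 := ℝ) one_lt_two
  refine ((normSeries_sub_sum_isBigO f 2).trans_isLittleO h).congr (fun x => ?_) fun x => ?_
  · simp [Finset.sum_range_succ, f.map_zero, normSeries_zero]
    ring
  · simp

lemma logCoeff_zero : logCoeff f 0 = 0 := by
  simp [logCoeff, normSeries_zero]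

lemma logCoeff_one : logCoeff f 1 = ‖f.toFun 1‖ ^ 2 := by
  have h := (hasDerivAt_normSeries_zero f).log (by rw [normSeries_zero]; exact one_ne_zero)
  rw [logCoeff, iteratedDeriv_one, h.deriv, normSeries_zero]
  simp

/-- As `c₁` is the linear coefficient of `ln N` in `x = |α|²`, the linear term of `N(x) exp (-c₁ x)`
vanishes: the Taylor polynomials are `1 + x² R(x)`. -/
lemma exists_taylor_normSeries_mul_exp (N : ℕ) : ∃ R : Polynomial ℂ,
    (fun x : ℝ => (normSeries f x : ℂ) * Complex.exp (-(logCoeff f 1 * x : ℝ)) -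
      (1 + Polynomial.X ^ 2 * R).eval (x : ℂ)) =O[𝓝 0] fun x : ℝ => x ^ (N + 2) := by
  set c := logCoeff f 1 with hc
  let P : Polynomial ℂ := ∑ k ∈ Finset.range (N + 2),
    Polynomial.C ((‖f.toFun k‖ ^ 2 / (k.factorial : ℝ) ^ 2 : ℝ) : ℂ) * Polynomial.X ^ k
  let E : Polynomial ℂ := ∑ k ∈ Finset.range (N + 2),
    Polynomial.C ((-(c : ℂ)) ^ k / (k.factorial : ℂ)) * Polynomial.X ^ k
  have hP : (fun x : ℝ => (normSeries f x : ℂ) - P.eval (x : ℂ)) =O[𝓝 0]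
      fun x : ℝ => x ^ (N + 2) := by
    refine (IsBigO.of_norm_left (IsBigO.congr_left
      (normSeries_sub_sum_isBigO f (N + 2)).norm_left fun x => ?_))
    rw [← Complex.norm_real]
    congr 1
    simp [P, Polynomial.eval_finsetSum]
  have hE : (fun x : ℝ => Complex.exp (-(c * x : ℝ)) - E.eval (x : ℂ)) =O[𝓝 0]
      fun x : ℝ => x ^ (N + 2) := by
    have hlin : (fun x : ℝ => -((c * x : ℝ) : ℂ)) =O[𝓝 0] fun x : ℝ => x :=
      IsBigO.of_bound |c| (Eventually.of_forall fun x => by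
        rw [norm_neg, Complex.norm_real, norm_mul, Real.norm_eq_abs c])
    refine (((Complex.exp_sub_sum_range_isBigO_pow (N + 2)).comp_tendsto
      (hlin.trans_tendsto tendsto_id)).trans (hlin.pow (N + 2))).congr_left fun x => ?_
    simp only [Function.comp_apply, E, Polynomial.eval_finsetSum]
    congr 1
    refine Finset.sum_congr rfl fun k _ => ?_
    rw [Polynomial.eval_mul, Polynomial.eval_C, Polynomial.eval_pow, Polynomial.eval_X,
      Complex.ofReal_mul, ← neg_mul, mul_pow]
    ring
  have hcoeff : ∀ (u : ℕ → ℂ) (n : ℕ), n < N + 2 →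
      (∑ k ∈ Finset.range (N + 2), Polynomial.C (u k) * Polynomial.X ^ k).coeff n = u n := by
    intro u n hn
    simp only [Polynomial.finsetSum_coeff, Polynomial.coeff_C_mul_X_pow]
    rw [Finset.sum_ite_eq, if_pos (Finset.mem_range.2 hn)]
  have hT0 : (P * E).coeff 0 = 1 := by
    rw [Polynomial.mul_coeff_zero, hcoeff _ 0 (by omega), hcoeff _ 0 (by omega)]
    simp [f.map_zero]
  have hT1 : (P * E).coeff 1 = 0 := by
    rw [Polynomial.mul_coeff_one, hcoeff _ 0 (by omega), hcoeff _ 1 (by omega),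
      hcoeff _ 0 (by omega), hcoeff _ 1 (by omega), hc, logCoeff_one]
    simp [f.map_zero]
  refine ⟨(P * E).divX.divX, ?_⟩
  have hPE : 1 + Polynomial.X ^ 2 * (P * E).divX.divX = P * E := by
    conv_rhs => rw [← Polynomial.divX_mul_X_add (P * E), ← Polynomial.divX_mul_X_add (P * E).divX]
    rw [Polynomial.coeff_divX, hT0, zero_add, hT1, Polynomial.C_0, Polynomial.C_1]
    ring
  rw [hPE]
  have hE1 : (fun x : ℝ => Complex.exp (-(c * x : ℝ))) =O[𝓝 0] fun _ => (1 : ℝ) := by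
    have : Continuous fun x : ℝ => Complex.exp (-(c * x : ℝ)) := by fun_prop
    exact (this.tendsto 0).isBigO_one ℝ
  have hP1 : (fun x : ℝ => P.eval (x : ℂ)) =O[𝓝 0] fun _ => (1 : ℝ) :=
    ((P.continuous.comp Complex.continuous_ofReal).tendsto 0).isBigO_one ℝ
  refine ((hP.mul hE1).add (hE.mul hP1)).congr (fun x => ?_) fun x => mul_one _
  rw [Polynomial.eval_mul]
  ring

end Normalization

/-! ### The expansion of the `Q`-function -/

section QFunction

open Asymptotics Filter Topology

variable {M : ℕ} (f : BosonicFactor)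

/-- The coefficient `∏ⱼ f(nⱼ) / nⱼ!` of the monomial `αⁿ` in `⟨n|α⟩`, before normalization. -/
noncomputable def ketWeight (n : Fin M → ℕ) : ℂ :=
  ∏ j, f.toFun (n j) / ((n j).factorial : ℂ)

/-- The coherent state without its normalization, `∑ₙ αⁿ f(n) / n! |n⟩`. -/
noncomputable def unnormalizedKet (α : Fin M → ℂ) : FockSpace M :=
  (∏ j, (Real.sqrt (normalization f (α j)) : ℂ)) • coherentKet f α

/-- The component of `unnormalizedKet f α` on the Fock states with fewer than `K` particles in each
mode. -/
noncomputable def truncatedKet (K : ℕ) (α : Fin M → ℂ) : FockSpace M :=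
  ∑ n ∈ Fintype.piFinset fun _ : Fin M => Finset.range K,
    (ketWeight f n * ∏ j, α j ^ n j) • fockKet n

lemma unnormalizedKet_apply (α : Fin M → ℂ) (n : Fin M → ℕ) :
    unnormalizedKet f α n = ketWeight f n * ∏ j, α j ^ n j := by
  change (∏ j, (Real.sqrt (normalization f (α j)) : ℂ)) * ∏ j, coherentCoeff f (α j) (n j) = _
  rw [ketWeight, ← Finset.prod_mul_distrib, ← Finset.prod_mul_distrib]
  refine Finset.prod_congr rfl fun j _ => ?_
  have : (Real.sqrt (normalization f (α j)) : ℂ) ≠ 0 :=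
    Complex.ofReal_ne_zero.2 (Real.sqrt_ne_zero'.2 (normalization_pos f _))
  rw [coherentCoeff]
  field_simp

lemma truncatedKet_apply (K : ℕ) (α : Fin M → ℂ) (n : Fin M → ℕ) :
    truncatedKet f K α n = if ∀ j, n j < K then unnormalizedKet f α n else 0 := by
  have h : truncatedKet f K α n = ∑ m ∈ Fintype.piFinset fun _ : Fin M => Finset.range K,
      if n = m then unnormalizedKet f α n else 0 := by
    rw [truncatedKet, lp.coeFn_sum, Finset.sum_apply]
    refine Finset.sum_congr rfl fun m _ => ?_
    rw [unnormalizedKet_apply]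
    by_cases hnm : n = m
    · subst hnm
      simp [fockKet]
    · simp [fockKet, hnm]
  rw [h, Finset.sum_ite_eq]
  simp

lemma unnormalizedKet_smul_apply (r : ℝ) (α : Fin M → ℂ) (n : Fin M → ℕ) :
    unnormalizedKet f (r • α) n = (r : ℂ) ^ (∑ j, n j) * unnormalizedKet f α n := by
  simp only [unnormalizedKet_apply, Pi.smul_apply, Complex.real_smul, mul_pow,
    Finset.prod_mul_distrib, Finset.prod_pow_eq_pow_sum]
  ring

lemma norm_unnormalizedKet_smul_le {r : ℝ} (hr : |r| ≤ 1) (α : Fin M → ℂ) :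
    ‖unnormalizedKet f (r • α)‖ ≤ ‖unnormalizedKet f α‖ := by
  refine lp.norm_mono two_ne_zero fun n => ?_
  rw [unnormalizedKet_smul_apply, norm_mul, norm_pow, Complex.norm_real, Real.norm_eq_abs]
  exact mul_le_of_le_one_left (norm_nonneg _) (pow_le_one₀ (abs_nonneg r) hr)

lemma norm_truncatedKet_le (K : ℕ) (α : Fin M → ℂ) :
    ‖truncatedKet f K α‖ ≤ ‖unnormalizedKet f α‖ := by
  refine lp.norm_mono two_ne_zero fun n => ?_
  rw [truncatedKet_apply]
  split_ifs
  · exact le_rfl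
  · rw [norm_zero]; exact norm_nonneg _

lemma norm_unnormalizedKet_sub_truncatedKet_le (K : ℕ) {r : ℝ} (hr : |r| ≤ 1) (α : Fin M → ℂ) :
    ‖unnormalizedKet f (r • α) - truncatedKet f K (r • α)‖ ≤ |r| ^ K * ‖unnormalizedKet f α‖ := by
  have h : ‖unnormalizedKet f (r • α) - truncatedKet f K (r • α)‖ ≤
      ‖((r : ℂ) ^ K) • unnormalizedKet f α‖ := by
    refine lp.norm_mono two_ne_zero fun n => ?_
    rw [lp.coeFn_sub, Pi.sub_apply, truncatedKet_apply, lp.coeFn_smul, Pi.smul_apply, smul_eq_mul]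
    split_ifs with hn
    · rw [sub_self, norm_zero]; exact norm_nonneg _
    · push Not at hn
      obtain ⟨j, hj⟩ := hn
      rw [sub_zero, unnormalizedKet_smul_apply, norm_mul, norm_mul, norm_pow, norm_pow,
        Complex.norm_real, Real.norm_eq_abs]
      exact mul_le_mul_of_nonneg_right (pow_le_pow_of_le_one (abs_nonneg r) hr
        (hj.trans (Finset.single_le_sum (fun i _ => Nat.zero_le (n i)) (Finset.mem_univ j))))
        (norm_nonneg _)
  rwa [norm_smul, norm_pow, Complex.norm_real, Real.norm_eq_abs] at h

/-- The Taylor polynomial of `⟨K(α)|ρ|K(α)⟩`, where `K(α)` is the unnormalized coherent state: the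
coefficient of `αˡ (α^*)ᵐ` is the matrix element `⟨m|ρ|l⟩` up to the weights of `l` and `m`. -/
noncomputable def matrixElementPoly (K : ℕ) (ρ : FockSpace M →L[ℂ] FockSpace M) :
    MvPolynomial (Fin M ⊕ Fin M) ℂ :=
  ∑ m ∈ Fintype.piFinset fun _ : Fin M => Finset.range K,
    ∑ l ∈ Fintype.piFinset fun _ : Fin M => Finset.range K,
      monomial (Finsupp.equivFunOnFinite.symm (Sum.elim l m))
        (star (ketWeight f m) * ketWeight f l * inner ℂ (fockKet m) (ρ (fockKet l)))

lemma eval_matrixElementPoly (K : ℕ) (ρ : FockSpace M →L[ℂ] FockSpace M) (α : Fin M → ℂ) :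
    eval (phaseVec α) (matrixElementPoly f K ρ) =
      inner ℂ (truncatedKet f K α) (ρ (truncatedKet f K α)) := by
  rw [matrixElementPoly, truncatedKet, sum_inner, map_sum]
  refine Finset.sum_congr rfl fun m _ => ?_
  rw [map_sum, map_sum, inner_sum]
  refine Finset.sum_congr rfl fun l _ => ?_
  rw [map_smul, inner_smul_left, inner_smul_right, eval_monomial,
    Finsupp.prod_fintype _ _ fun i => pow_zero _, Fintype.prod_sum_type]
  simp only [phaseVec, Finsupp.equivFunOnFinite_symm_apply_apply, Sum.elim_inl, Sum.elim_inr,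
    map_mul, map_prod, map_pow, Pi.star_apply, starRingEnd_apply]
  ring

lemma rayExpansion_matrixElementPoly (N : ℕ) (ρ : FockSpace M →L[ℂ] FockSpace M) :
    RayExpansion N (fun α => inner ℂ (unnormalizedKet f α) (ρ (unnormalizedKet f α)))
      (matrixElementPoly f (N + 1) ρ) := by
  intro α
  refine IsBigO.of_bound (2 * ‖ρ‖ * ‖unnormalizedKet f α‖ ^ 2) ?_
  filter_upwards [Metric.closedBall_mem_nhds (0 : ℝ) one_pos] with r hr
  replace hr : |r| ≤ 1 := by simpa using hr
  rw [eval_matrixElementPoly, norm_pow, Real.norm_eq_abs]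
  set k := ‖unnormalizedKet f α‖
  set x := unnormalizedKet f (r • α) with hx
  set y := truncatedKet f (N + 1) (r • α) with hy
  have hxk : ‖x‖ ≤ k := norm_unnormalizedKet_smul_le f hr α
  have hyk : ‖y‖ ≤ k := (norm_truncatedKet_le f (N + 1) _).trans hxk
  have hxy : ‖x - y‖ ≤ |r| ^ (N + 1) * k := norm_unnormalizedKet_sub_truncatedKet_le f _ hr α
  have hk : 0 ≤ k := norm_nonneg _
  have hsplit : inner ℂ x (ρ x) - inner ℂ y (ρ y) =
      inner ℂ (x - y) (ρ x) + inner ℂ y (ρ (x - y)) := by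
    rw [map_sub, inner_sub_left, inner_sub_right]
    ring
  rw [hsplit]
  have h1 : ‖inner ℂ (x - y) (ρ x)‖ ≤ (|r| ^ (N + 1) * k) * (‖ρ‖ * k) :=
    (norm_inner_le_norm _ _).trans (mul_le_mul hxy ((ρ.le_opNorm x).trans
      (mul_le_mul_of_nonneg_left hxk (norm_nonneg _))) (norm_nonneg _) (by positivity))
  have h2 : ‖inner ℂ y (ρ (x - y))‖ ≤ k * (‖ρ‖ * (|r| ^ (N + 1) * k)) :=
    (norm_inner_le_norm _ _).trans (mul_le_mul hyk ((ρ.le_opNorm _).trans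
      (mul_le_mul_of_nonneg_left hxy (norm_nonneg _))) (norm_nonneg _) hk)
  refine (norm_add_le _ _).trans ((add_le_add h1 h2).trans_eq ?_)
  ring

lemma coeff_matrixElementPoly (K : ℕ) (ρ : FockSpace M →L[ℂ] FockSpace M) (n : Fin M → ℕ)
    (hn : ∀ j, n j < K) :
    coeff (Finsupp.equivFunOnFinite.symm (Sum.elim n n)) (matrixElementPoly f K ρ) =
      star (ketWeight f n) * ketWeight f n * inner ℂ (fockKet n) (ρ (fockKet n)) := by
  have hmem : n ∈ Fintype.piFinset fun _ : Fin M => Finset.range K := by simpa using hn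
  have hne : ∀ {m l : Fin M → ℕ}, m ≠ n ∨ l ≠ n →
      (Finsupp.equivFunOnFinite.symm (Sum.elim l m) : Fin M ⊕ Fin M →₀ ℕ) ≠
        Finsupp.equivFunOnFinite.symm (Sum.elim n n) := by
    intro m l h he
    have he' := Finsupp.equivFunOnFinite.symm.injective he
    rcases h with h | h
    · exact h (funext fun j => congrFun he' (Sum.inr j))
    · exact h (funext fun j => congrFun he' (Sum.inl j))
  rw [matrixElementPoly, coeff_sum, Finset.sum_eq_single_of_mem n hmem, coeff_sum,
    Finset.sum_eq_single_of_mem n hmem, coeff_monomial, if_pos rfl]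
  · intro l _ hl
    rw [coeff_monomial, if_neg (hne (Or.inr hl))]
  · intro m _ hm
    rw [coeff_sum]
    exact Finset.sum_eq_zero fun l _ => by rw [coeff_monomial, if_neg (hne (Or.inl hm))]

lemma inner_apply_self_eq_re {ρ : FockSpace M →L[ℂ] FockSpace M} (hρ : ρ.IsPositive)
    (x : FockSpace M) : inner ℂ x (ρ x) = ((inner ℂ x (ρ x)).re : ℂ) := by
  refine (Complex.conj_eq_iff_re.1 ?_).symm
  rw [inner_conj_symm]
  exact hρ.1 x x

/-- The `Q`-function in terms of the unnormalized coherent states. -/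
lemma inner_unnormalizedKet_eq_qFunction {κ : ℝ} (hκ : 0 < κ)
    {ρ : FockSpace M →L[ℂ] FockSpace M} (hρ : ρ.IsPositive) (α : Fin M → ℂ) :
    inner ℂ (unnormalizedKet f α) (ρ (unnormalizedKet f α)) =
      (κ ^ M : ℂ) * (∏ j, (normalization f (α j) : ℂ)) * (qFunction f κ ρ α : ℂ) := by
  have hκ' : (κ : ℂ) ^ M ≠ 0 := pow_ne_zero _ (Complex.ofReal_ne_zero.2 hκ.ne')
  rw [qFunction, Complex.ofReal_mul, ← inner_apply_self_eq_re hρ, unnormalizedKet, map_smul,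
    inner_smul_left, inner_smul_right, ← mul_assoc, map_prod, ← Finset.prod_mul_distrib]
  have : ∀ j, (starRingEnd ℂ) (Real.sqrt (normalization f (α j)) : ℂ) *
      (Real.sqrt (normalization f (α j)) : ℂ) = (normalization f (α j) : ℂ) := fun j => by
    rw [Complex.conj_ofReal, ← Complex.ofReal_mul, Real.mul_self_sqrt (normalization_pos f _).le]
  simp only [this]
  push_cast
  field_simp

end QFunction

/-! ### The exponent of a Gaussian -/

section Exponent

variable {M : ℕ} {σ : Matrix (Fin M ⊕ Fin M) (Fin M ⊕ Fin M) ℂ}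

lemma star_phaseVec (α : Fin M → ℂ) : star (phaseVec α) = phaseVec α ∘ Sum.swap := by
  ext i
  cases i <;> simp [phaseVec]

lemma fromBlocks_zero_one_one_zero_mul (B : Matrix (Fin M ⊕ Fin M) (Fin M ⊕ Fin M) ℂ) :
    Matrix.fromBlocks 0 1 1 0 * B = B.submatrix Sum.swap id := by
  ext i j
  cases i <;> simp [Matrix.mul_apply, Fintype.sum_sum_type, Matrix.one_apply]

lemma comp_swap_dotProduct (v u : Fin M ⊕ Fin M → ℂ) :
    (v ∘ Sum.swap) ⬝ᵥ u = v ⬝ᵥ (u ∘ Sum.swap) := by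
  rw [dotProduct, dotProduct, ← Equiv.sum_comp (Equiv.sumComm (Fin M) (Fin M))]
  simp

/-- The matrix `[[0, I], [I, 0]] σ⁻¹` of the bilinear form `v ↦ v† σ⁻¹ v`, on vectors `(α, α^*)`,
is symmetric. -/
lemma IsCovariance.swap_inv_isSymm (hσ : IsCovariance σ) :
    (σ⁻¹.submatrix Sum.swap id).IsSymm := by
  have h1 : σ.submatrix (Equiv.sumComm _ _) (Equiv.sumComm _ _) = σᵀ := by
    ext i j
    exact (hσ.map_swap i j).trans (hσ.posDef.isHermitian.apply j i)
  have h2 : σ⁻¹.submatrix (Equiv.sumComm _ _) (Equiv.sumComm _ _) = σ⁻¹ᵀ := by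
    rw [← Matrix.inv_submatrix_equiv, h1, Matrix.transpose_nonsing_inv]
  ext i j
  have h3 := congrFun (congrFun h2 i) (Sum.swap j)
  simpa using h3.symm

lemma IsCovariance.invQuadForm_eq (hσ : IsCovariance σ) (α : Fin M → ℂ) :
    (invQuadForm σ α : ℂ) = phaseVec α ⬝ᵥ (σ⁻¹.submatrix Sum.swap id *ᵥ phaseVec α) := by
  have him : (star (phaseVec α) ⬝ᵥ (σ⁻¹ *ᵥ phaseVec α)).im = 0 :=
    hσ.posDef.isHermitian.inv.im_star_dotProduct_mulVec_self (phaseVec α)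
  have hre : (invQuadForm σ α : ℂ) = star (phaseVec α) ⬝ᵥ (σ⁻¹ *ᵥ phaseVec α) :=
    Complex.ext (by simp [invQuadForm]) (by simp [him])
  rw [hre, star_phaseVec, comp_swap_dotProduct]
  rfl

lemma linearCoeff_eq (δ : Fin M → ℂ) :
    linearCoeff σ δ = phaseVec δ ᵥ* σ⁻¹.submatrix Sum.swap id := by
  ext i
  rw [linearCoeff, star_phaseVec, Matrix.vecMul, comp_swap_dotProduct]
  rfl

lemma eval_linearPoly {ι : Type*} [Fintype ι] (F v : ι → ℂ) :
    eval v (linearPoly F) = F ⬝ᵥ v := by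
  simp [linearPoly, dotProduct]

lemma eval_quadraticPoly {ι : Type*} [Fintype ι] (A : Matrix ι ι ℂ) (v : ι → ℂ) :
    eval v (quadraticPoly A) = (v ⬝ᵥ (A *ᵥ v)) / 2 := by
  simp only [quadraticPoly, map_sum, map_mul, eval_C, eval_X, dotProduct, Matrix.mulVec,
    Fintype.sum_prod_type, Finset.mul_sum, Finset.sum_div]
  refine Finset.sum_congr rfl fun i _ => Finset.sum_congr rfl fun j _ => ?_
  ring

lemma quadraticForm_gbsMatrix (f : BosonicFactor) (α : Fin M → ℂ) :
    phaseVec α ⬝ᵥ (gbsMatrix f σ *ᵥ phaseVec α) =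
      2 * ∑ j, ((logCoeff f 1 * ‖α j‖ ^ 2 : ℝ) : ℂ) -
        phaseVec α ⬝ᵥ (σ⁻¹.submatrix Sum.swap id *ᵥ phaseVec α) := by
  have h : (((1 : Matrix (Fin M ⊕ Fin M) (Fin M ⊕ Fin M) ℂ).submatrix Sum.swap id) *ᵥ phaseVec α) =
      star (phaseVec α) := by
    rw [star_phaseVec]
    ext i
    change ((1 : Matrix (Fin M ⊕ Fin M) (Fin M ⊕ Fin M) ℂ) *ᵥ phaseVec α) (Sum.swap i) = _
    rw [Matrix.one_mulVec]
    rfl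
  rw [gbsMatrix, fromBlocks_zero_one_one_zero_mul, Matrix.submatrix_sub, Pi.sub_apply,
    Pi.sub_apply, Matrix.submatrix_smul, Pi.smul_apply, Pi.smul_apply, Matrix.sub_mulVec,
    Matrix.smul_mulVec, dotProduct_sub, dotProduct_smul, h]
  congr 1
  simp only [dotProduct, Fintype.sum_sum_type, phaseVec, Pi.star_apply, Sum.elim_inl, Sum.elim_inr,
    star_star, smul_eq_mul, Complex.ofReal_mul, Complex.ofReal_pow, ← Complex.mul_conj',
    ← Finset.mul_sum, starRingEnd_apply]
  simp only [mul_comm (star (α _))]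
  ring

/-- The exponent of a displaced Gaussian is `½ vᵀ A v + F v - ∑ⱼ c₁ |αⱼ|²` up to its value at
`α = 0`, where `v = (α, α^*)`, `A = gbsMatrix f σ` and `F = linearCoeff σ δ`. -/
lemma IsCovariance.exponent_eq (hσ : IsCovariance σ) (f : BosonicFactor) (α δ : Fin M → ℂ) :
    ((-(1 / 2) * invQuadForm σ (α - δ) : ℝ) : ℂ) =
      ((-(1 / 2) * invQuadForm σ δ : ℝ) : ℂ) +
        ∑ j, -((logCoeff f 1 * ‖α j‖ ^ 2 : ℝ) : ℂ) +
        (eval (phaseVec α) (quadraticPoly (gbsMatrix f σ)) +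
          eval (phaseVec α) (linearPoly (linearCoeff σ δ))) := by
  have hsub : phaseVec (α - δ) = phaseVec α - phaseVec δ := by
    ext i
    cases i <;> simp [phaseVec]
  have hcross : phaseVec α ⬝ᵥ (σ⁻¹.submatrix Sum.swap id *ᵥ phaseVec δ) =
      phaseVec δ ⬝ᵥ (σ⁻¹.submatrix Sum.swap id *ᵥ phaseVec α) := by
    conv_lhs => rw [← hσ.swap_inv_isSymm, Matrix.mulVec_transpose, dotProduct_comm]
    rw [Matrix.dotProduct_mulVec]
  rw [Complex.ofReal_mul, Complex.ofReal_mul, hσ.invQuadForm_eq, hσ.invQuadForm_eq, hsub,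
    eval_quadraticPoly, eval_linearPoly, quadraticForm_gbsMatrix, linearCoeff_eq,
    ← Matrix.dotProduct_mulVec, Matrix.mulVec_sub, sub_dotProduct, dotProduct_sub, dotProduct_sub,
    hcross, Finset.sum_neg_distrib]
  push_cast
  ring

end Exponent

/-! ### Outcome probabilities -/

section Outcome

variable {M : ℕ}

lemma sqfreeExponent_clickSet {n : Fin M → ℕ} (hn : ∀ j, n j = 0 ∨ n j = 1) :
    sqfreeExponent (clickSet n) = Finsupp.equivFunOnFinite.symm (Sum.elim n n) := by
  ext i
  rw [sqfreeExponent_apply]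
  rcases i with j | j <;> rcases hn j with h | h <;> simp [clickSet, h]

lemma star_ketWeight_mul_ketWeight (f : BosonicFactor) {n : Fin M → ℕ}
    (hn : ∀ j, n j = 0 ∨ n j = 1) :
    star (ketWeight f n) * ketWeight f n = ((∏ j, ‖f.toFun (n j)‖ ^ 2 : ℝ) : ℂ) := by
  rw [← starRingEnd_apply, Complex.conj_mul', ketWeight, norm_prod, ← Complex.ofReal_pow,
    ← Finset.prod_pow]
  congr 1
  refine Finset.prod_congr rfl fun j _ => ?_
  rcases hn j with h | h <;> simp [h]

/-- The probabilities of a displaced Gaussian state: `Q` is expanded in `α` and `α^*` in two ways,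
and the coefficients of the square-free monomial of `clickSet n` are compared. -/
lemma outcomeProb_of_hasGaussianQ (f : BosonicFactor) {κ : ℝ} (hκ : 0 < κ)
    {ρ : FockSpace M →L[ℂ] FockSpace M} (hρ : IsDensityOperator ρ)
    {σ : Matrix (Fin M ⊕ Fin M) (Fin M ⊕ Fin M) ℂ} (hσ : IsCovariance σ) {g : ℝ}
    {n : Fin M → ℕ} (hn : ∀ j, n j = 0 ∨ n j = 1) {δ : Fin M → ℂ}
    (hQ : HasGaussianQ f κ ρ σ δ g) :
    (outcomeProb ρ n : ℂ) =
      ((κ ^ M * Real.exp (logCoeff f 0 * M) * Real.exp (-(1 / 2) * invQuadForm σ δ) /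
        (g * (∏ j, ‖f.toFun (n j)‖ ^ 2) * Real.sqrt σ.det.re) : ℝ) : ℂ) *
      ∑ B ∈ (clickSet n).powerset,
        (∏ k ∈ B, linearCoeff σ δ k) * hafnianOn (gbsMatrix f σ) (clickSet n \ B) := by
  set S := clickSet n with hS
  -- any order that is at least the degree `S.card` of the coefficient in question will do
  set N := S.card + 1 with hN
  obtain ⟨R, hR⟩ := exists_taylor_normSeries_mul_exp f S.card
  let c : ℂ := ((κ ^ M * (1 / (g * Real.sqrt σ.det.re)) *
    Real.exp (-(1 / 2) * invQuadForm σ δ) : ℝ) : ℂ)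
  let p : Fin M → MvPolynomial (Fin M ⊕ Fin M) ℂ := fun j =>
    Polynomial.aeval (X (Sum.inl j) * X (Sum.inr j)) (1 + Polynomial.X ^ 2 * R)
  have hp : RayExpansion N (fun α : Fin M → ℂ => ∏ j, ((normSeries f (‖α j‖ ^ 2) : ℂ) *
      Complex.exp (-(logCoeff f 1 * ‖α j‖ ^ 2 : ℝ)))) (∏ j, p j) :=
    RayExpansion.prod Finset.univ fun j _ => rayExpansion_normSq
      (h := fun x => (normSeries f x : ℂ) * Complex.exp (-(logCoeff f 1 * x : ℝ))) hR j
  have hright := (rayExpansion_C N c).mul (hp.mul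
    ((rayExpansion_exp N (isHomogeneous_linearPoly (linearCoeff σ δ)) one_pos).mul
      (rayExpansion_exp N (isHomogeneous_quadraticPoly (gbsMatrix f σ)) two_pos)))
  have hleft := rayExpansion_matrixElementPoly f N ρ
  have hfun : (fun α : Fin M → ℂ => inner ℂ (unnormalizedKet f α) (ρ (unnormalizedKet f α))) =
      fun α => c * ((∏ j, ((normSeries f (‖α j‖ ^ 2) : ℂ) *
        Complex.exp (-(logCoeff f 1 * ‖α j‖ ^ 2 : ℝ)))) *
        (Complex.exp (eval (phaseVec α) (linearPoly (linearCoeff σ δ))) *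
          Complex.exp (eval (phaseVec α) (quadraticPoly (gbsMatrix f σ))))) := by
    funext α
    rw [inner_unnormalizedKet_eq_qFunction f hκ hρ.isPositive, hQ.eq_gaussian, Complex.ofReal_mul,
      Complex.ofReal_exp, hσ.exponent_eq f, Complex.exp_add, Complex.exp_add, Complex.exp_add,
      Complex.exp_sum, ← Complex.ofReal_exp, Finset.prod_mul_distrib]
    simp only [c, normalization]
    push_cast
    ring
  rw [hfun] at hleft
  have hcoeff := hleft.coeff_eq hright (m := sqfreeExponent S)
    (by rw [degree_sqfreeExponent]; omega)
  have hprod : ∏ j, p j = ∏ j, (1 + X (Sum.inl j) ^ 2 *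
      (X (Sum.inr j) ^ 2 * Polynomial.aeval (X (Sum.inl j) * X (Sum.inr j)) R)) :=
    Finset.prod_congr rfl fun j _ => by
      simp only [p, map_add, map_one, map_mul, map_pow, Polynomial.aeval_X]
      ring
  rw [coeff_C_mul, hprod, coeff_sqfreeExponent_prod_mul, coeff_sqfreeExponent_mul,
    sqfreeExponent_clickSet hn, coeff_matrixElementPoly f _ ρ n
      (fun j => by rcases hn j with h | h <;> omega),
    star_ketWeight_mul_ketWeight f hn, inner_apply_self_eq_re hρ.isPositive] at hcoeff
  have hsum : ∀ B ∈ S.powerset,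
      coeff (sqfreeExponent B) (expTrunc N (linearPoly (linearCoeff σ δ))) *
        coeff (sqfreeExponent (S \ B)) (expTrunc N (quadraticPoly (gbsMatrix f σ))) =
      (∏ k ∈ B, linearCoeff σ δ k) * hafnianOn (gbsMatrix f σ) (S \ B) := by
    intro B hB
    have hB' := Finset.card_le_card (Finset.mem_powerset.1 hB)
    have hSB := Finset.card_le_card (Finset.sdiff_subset (s := S) (t := B))
    rw [coeff_expTrunc_linearPoly N _ B (by omega),
      coeff_expTrunc_quadraticPoly N _ (S \ B) (by omega)]
  rw [Finset.sum_congr rfl hsum] at hcoeff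
  have hf : (∏ j, ‖f.toFun (n j)‖ ^ 2) ≠ 0 := by
    refine Finset.prod_ne_zero_iff.2 fun j _ => pow_ne_zero 2 (norm_ne_zero_iff.2 ?_)
    rcases hn j with h | h
    · rw [h, f.map_zero]; exact one_ne_zero
    · rw [h]; exact f.map_one_ne_zero
  have hc : ((κ ^ M * Real.exp (logCoeff f 0 * M) * Real.exp (-(1 / 2) * invQuadForm σ δ) /
      (g * (∏ j, ‖f.toFun (n j)‖ ^ 2) * Real.sqrt σ.det.re) : ℝ) : ℂ) =
      ((∏ j, ‖f.toFun (n j)‖ ^ 2 : ℝ) : ℂ)⁻¹ * c := by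
    rw [← Complex.ofReal_inv, ← Complex.ofReal_mul, logCoeff_zero, zero_mul, Real.exp_zero]
    congr 1
    simp only [div_eq_mul_inv, mul_inv]
    ring
  rw [hc, mul_assoc, ← hcoeff, inv_mul_cancel_left₀ (Complex.ofReal_ne_zero.2 hf), outcomeProb]

end Outcome

end GenBoson

theorem mainTheorem2 {M : ℕ} (f : GenBoson.BosonicFactor) (κ : ℝ) (hκ : 0 < κ)
    (ρ : GenBoson.FockSpace M →L[ℂ] GenBoson.FockSpace M) (hρ : GenBoson.IsDensityOperator ρ)
    (σ : Matrix (Fin M ⊕ Fin M) (Fin M ⊕ Fin M) ℂ) (hσ : GenBoson.IsCovariance σ) (g : ℝ)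
    (n : Fin M → ℕ) (hn : ∀ j, n j = 0 ∨ n j = 1) :
    (GenBoson.HasGaussianQ f κ ρ σ 0 g →
      (GenBoson.outcomeProb ρ n : ℂ) =
        ((κ ^ M * Real.exp (GenBoson.logCoeff f 0 * M) /
          (g * (∏ j, ‖f.toFun (n j)‖ ^ 2) * Real.sqrt σ.det.re) : ℝ) : ℂ) *
        GenBoson.hafnianOn (GenBoson.gbsMatrix f σ) (GenBoson.clickSet n)) ∧
    (∀ δ : Fin M → ℂ, GenBoson.HasGaussianQ f κ ρ σ δ g →
      (GenBoson.outcomeProb ρ n : ℂ) =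
        ((κ ^ M * Real.exp (GenBoson.logCoeff f 0 * M) *
            Real.exp (-(1 / 2) * GenBoson.invQuadForm σ δ) /
          (g * (∏ j, ‖f.toFun (n j)‖ ^ 2) * Real.sqrt σ.det.re) : ℝ) : ℂ) *
        ∑ B ∈ (GenBoson.clickSet n).powerset,
          (∏ k ∈ B, GenBoson.linearCoeff σ δ k) *
            GenBoson.hafnianOn (GenBoson.gbsMatrix f σ) (GenBoson.clickSet n \ B)) := by
  refine ⟨fun hQ => ?_, fun δ hQ => GenBoson.outcomeProb_of_hasGaussianQ f hκ hρ hσ hn hQ⟩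
  have h0 : GenBoson.phaseVec (0 : Fin M → ℂ) = 0 := by
    ext i
    cases i <;> simp [GenBoson.phaseVec]
  have hF : GenBoson.linearCoeff σ 0 = 0 := by simp [GenBoson.linearCoeff, h0]
  have hq : GenBoson.invQuadForm σ 0 = 0 := by simp [GenBoson.invQuadForm, h0]
  -- without displacement only the term of `B = ∅` is left
  rw [GenBoson.outcomeProb_of_hasGaussianQ f hκ hρ hσ hn hQ, hF, hq, mul_zero, Real.exp_zero,
    mul_one, Finset.sum_eq_single_of_mem ∅ (Finset.empty_mem_powerset _), Finset.prod_empty,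
    one_mul, Finset.sdiff_empty]
  intro B _ hB
  obtain ⟨k, hk⟩ := Finset.nonempty_iff_ne_empty.2 hB
  rw [Finset.prod_eq_zero hk (Pi.zero_apply k), zero_mul]
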